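/- Let $H$ be a real separable Hilbert space, let $\mu$ be a Borel probability measure on $H$ with bounded support, and let $d\ge 0$ be an integer with $d\le\dim H$ (where $\dim H\le\infty$). A $d$-flat is a $d$-dimensional affine subspace of $H$; let $\mathrm{AG}_d(H)$ be the set of all $d$-flats, and put $$e_2(\mu,d)=\inf_{L\in \mathrm{AG}_d(H)}\Big(\int \operatorname{dist}^2(x,L)\,d\mu(x)\Big)^{1/2}.$$ A least squares (LS) $d$-flat for $\mu$ is a $d$-flat at which this infimum is attained. Let $x_{\mathrm{cm}}=\int x\,d\mu(x)$ be the center of mass of $\mu$, and let $A_\mu:H\to L_2(\mu)$, $(A_\mu y)(x)=\langle y,x-x_{\mathrm{cm}}\rangle$, be the data-to-features operator. Let $\sigma_1\ge\sigma_2\ge\cdots\ge 0$ be the singular values of $A_\mu$, i.e. the square roots of the eigenvalues of $A_\mu^*A_\mu$, repeated according to multiplicity, with $\sigma_i=0$ for $i>\dim H$. Vectors $v_1,\dots,v_d\in H$ are called top right singular vectors of $A_\mu$ if they are orthonormal and $A_\mu^*A_\mu v_i=\sigma_i^2v_i$ for $1\le i\le d$. Then: 1. An LS $d$-flat for $\mu$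 exists. Top right singular vectors $v_1,\dots,v_d$ of $A_\mu$ exist, and for every choice of them $x_{\mathrm{cm}}+\operatorname{Sp}\{v_1,\dots,v_d\}$ is an LS $d$-flat for $\mu$. 2. If $1\le d<\dim H$, then the LS $d$-flat is unique if and only if $\sigma_d>\sigma_{d+1}$. If $d=0$ or $d=\dim H$, it is always unique. 3. $\sum_{i>d}\sigma_i^2<\infty$ and $e_2(\mu,d)=\big(\sum_{i>d}\sigma_i^2\big)^{1/2}$. -/

import Mathlib

open MeasureTheory

noncomputable section

namespace LeastSquaresFlats

section Flats

variable {H : Type*} [NormedAddCommGroup H] [InnerProductSpace ℝ H]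

/-- The affine Grassmannian `AG_d(H)`: the set of all `d`-flats, that is, of all (nonempty) affine
subspaces of `H` of dimension `d`. The dimension is a cardinal, so that infinite-dimensional
subspaces are not counted as zero-dimensional. -/
def affineGrassmannian (H : Type*) [NormedAddCommGroup H] [InnerProductSpace ℝ H] (d : ℕ) :
    Set (AffineSubspace ℝ H) :=
  {L | (L : Set H).Nonempty ∧ Module.rank ℝ L.direction = (d : Cardinal)}

variable [MeasurableSpace H]

/-- The root mean square distance `(∫ dist(x, L)² dμ(x))^{1/2}` of `μ` to `L`. -/
def rmsDist (μ : Measure H) (L : AffineSubspace ℝ H) : ℝ :=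
  √(∫ x, Metric.infDist x (L : Set H) ^ 2 ∂μ)

/-- The `d`-dimensional least squares error `e₂(μ, d)`. -/
def lsError (μ : Measure H) (d : ℕ) : ℝ :=
  ⨅ L : affineGrassmannian H d, rmsDist μ (L : AffineSubspace ℝ H)

/-- `L` is a least squares `d`-flat for `μ`: a `d`-flat at which the root mean square distance
attains its minimum over all `d`-flats. -/
def IsLSFlat (μ : Measure H) (d : ℕ) (L : AffineSubspace ℝ H) : Prop :=
  L ∈ affineGrassmannian H d ∧ IsMinOn (rmsDist μ) (affineGrassmannian H d) L

/-- The center of mass `∫ x dμ(x)`. -/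
def centerOfMass (μ : Measure H) : H := ∫ x, x ∂μ

end Flats

section DataToFeatures

variable {H : Type*} [NormedAddCommGroup H] [InnerProductSpace ℝ H]
  [TopologicalSpace.SeparableSpace H] [MeasurableSpace H] [BorelSpace H]

/-- The centered data `x ↦ x - x_cm` is square integrable if `μ` has bounded support. -/
theorem memLp_sub_centerOfMass (μ : Measure H) [IsProbabilityMeasure μ]
    (hμ : Bornology.IsBounded μ.support) :
    MemLp (fun x : H => x - centerOfMass μ) 2 μ := by
  have : SecondCountableTopology H := UniformSpace.secondCountable_of_separable H
  obtain ⟨C, hC⟩ := hμ.exists_norm_le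
  have hid : MemLp (fun x : H => x) 2 μ := by
    refine MemLp.of_bound measurable_id.aestronglyMeasurable C ?_
    filter_upwards [Measure.support_mem_ae (μ := μ)] with x hx
    exact hC x hx
  exact hid.sub (memLp_const _)

/-- The data-to-features operator `A_μ : H → L²(μ)`, `(A_μ y)(x) = ⟪y, x - x_cm⟫`. -/
def dataToFeatures (μ : Measure H) [IsProbabilityMeasure μ]
    (hμ : Bornology.IsBounded μ.support) : H →L[ℝ] Lp ℝ 2 μ :=
  LinearMap.mkContinuous
    { toFun := fun y => (innerSL ℝ y).compLp ((memLp_sub_centerOfMass μ hμ).toLp _)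
      map_add' := fun y z => by rw [map_add, ContinuousLinearMap.add_compLp]
      map_smul' := fun c y => by
        rw [map_smul, ContinuousLinearMap.smul_compLp, RingHom.id_apply] }
    ‖(memLp_sub_centerOfMass μ hμ).toLp _‖
    (fun y => by
      have h := (innerSL ℝ y).norm_compLp_le ((memLp_sub_centerOfMass μ hμ).toLp _)
      rw [innerSL_apply_norm, mul_comm] at h
      exact h)

theorem dataToFeatures_ae (μ : Measure H) [IsProbabilityMeasure μ]
    (hμ : Bornology.IsBounded μ.support) (y : H) :
    dataToFeatures μ hμ y =ᵐ[μ] fun x => inner ℝ y (x - centerOfMass μ) := by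
  have h1 := (innerSL ℝ y).coeFn_compLp ((memLp_sub_centerOfMass μ hμ).toLp _)
  filter_upwards [h1, (memLp_sub_centerOfMass μ hμ).coeFn_toLp] with x hx hx'
  change ((innerSL ℝ y).compLp ((memLp_sub_centerOfMass μ hμ).toLp _)) x = _
  rw [hx, hx']
  rfl

end DataToFeatures

section SingularValues

variable {H F : Type*} [NormedAddCommGroup H] [InnerProductSpace ℝ H] [CompleteSpace H]
  [NormedAddCommGroup F] [InnerProductSpace ℝ F] [CompleteSpace F]

/-- The eigenspace of `A* A` for the eigenvalue `s ^ 2`; it consists of the right singular vectors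
of `A` for the singular value `s ≥ 0` (and of the zero vector). -/
def rightSingularSpace (A : H →L[ℝ] F) (s : ℝ) : Submodule ℝ H :=
  Module.End.eigenspace (((ContinuousLinearMap.adjoint A).comp A : H →L[ℝ] H) : H →ₗ[ℝ] H) (s ^ 2)

/-- The singular values of a compact operator `A`, in decreasing order, repeated according to
multiplicity, and numbered from zero (`singularValue A n` is `σ_{n+1}`): the largest `s ≥ 0` such
that the singular values `≥ s` of `A` have total multiplicity at least `n + 1`. The values beyond
the dimension of `H` are zero. -/
def singularValue (A : H →L[ℝ] F) (n : ℕ) : ℝ :=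
  sSup {s : ℝ | 0 ≤ s ∧
    (n : Cardinal) < Module.rank ℝ (⨆ t ∈ Set.Ici s, rightSingularSpace A t : Submodule ℝ H)}

/-- `v₁, …, v_d` are top right singular vectors of `A`: orthonormal eigenvectors of `A* A` for the
`d` largest eigenvalues `σ₁², …, σ_d²`, counted with multiplicity. -/
def IsTopRightSingularVectors (A : H →L[ℝ] F) {d : ℕ} (v : Fin d → H) : Prop :=
  Orthonormal ℝ v ∧ ∀ i : Fin d,
    (ContinuousLinearMap.adjoint A) (A (v i)) = (singularValue A (i : ℕ) ^ 2) • v i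

end SingularValues

end LeastSquaresFlats

end

open LeastSquaresFlats

/-!
By the parallel axis theorem, the mean square distance of `μ` to a flat `L` is that to the parallel
flat through the center of mass plus `dist² (x_cm, L)`. For a flat through the center of mass whose
direction has the orthonormal basis `u₁, …, u_d`, the mean square distance is the total variance
`∫ ‖x - x_cm‖² dμ = ∑ σᵢ²` minus `∑ ‖A uⱼ‖²`, and Ky Fan's principle says that
`∑ ‖A uⱼ‖² ≤ σ₁² + ⋯ + σ_d²`. More precisely, if `v₁, …, v_d` are top right singular vectors and `P`
is the orthogonal projection onto the span of the `uⱼ`, the deficit in this inequality is at least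
`∑ (σᵢ² - σ_{d+1}²) (1 - ‖P vᵢ‖²)`; so if `σ_d > σ_{d+1}`, equality forces the two spans to agree,
while if `σ_d = σ_{d+1}`, replacing `v_d` by `v_{d+1}` gives a second least squares flat.

Approximating the centered data in `L²(μ; H)` by simple functions, whose values span a
finite-dimensional space, gives both the compactness of `A` and the trace formula for `∑ σᵢ²`.
-/

namespace LeastSquaresFlats

open ContinuousLinearMap (adjoint)

section OrthonormalFamilies

variable {𝕜 E ι : Type*} [RCLike 𝕜] [NormedAddCommGroup E] [InnerProductSpace 𝕜 E]

instance finiteDimensional_span_range [Finite ι] (v : ι → E) :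
    FiniteDimensional 𝕜 (Submodule.span 𝕜 (Set.range v)) :=
  FiniteDimensional.span_of_finite 𝕜 (Set.finite_range v)

theorem rank_span_range_of_linearIndependent {n : ℕ} {v : Fin n → E}
    (hv : LinearIndependent 𝕜 v) : Module.rank 𝕜 (Submodule.span 𝕜 (Set.range v)) = n := by
  rw [← Module.finrank_eq_rank, finrank_span_eq_card hv, Fintype.card_fin]

theorem exists_orthonormal_span_eq {V : Submodule 𝕜 E} {d : ℕ} (hV : Module.rank 𝕜 V = d) :
    ∃ u : Fin d → E, Orthonormal 𝕜 u ∧ Submodule.span 𝕜 (Set.range u) = V := by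
  have : FiniteDimensional 𝕜 V := Module.rank_lt_aleph0_iff.1 (hV ▸ Cardinal.natCast_lt_aleph0)
  let b := (stdOrthonormalBasis 𝕜 V).reindex (finCongr (Module.finrank_eq_of_rank_eq hV))
  refine ⟨fun i => b i, b.orthonormal.comp_linearIsometry V.subtypeₗᵢ, ?_⟩
  have hspan : Submodule.span 𝕜 (Set.range b) = ⊤ := by simpa using b.toBasis.span_eq
  rw [show Set.range (fun i => (b i : E)) = V.subtype '' Set.range b from Set.range_comp _ _,
    Submodule.span_image, hspan, Submodule.map_subtype_top]

theorem mem_orthogonal_span_range {v : ι → E} {y : E} :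
    y ∈ (Submodule.span 𝕜 (Set.range v))ᗮ ↔ ∀ i, inner 𝕜 (v i) y = 0 := by
  rw [← Submodule.span_singleton_le_iff_mem, ← Submodule.isOrtho_iff_le, Submodule.isOrtho_comm,
    Submodule.isOrtho_span]
  simp

theorem orthonormal_snoc {n : ℕ} {v : Fin n → E} (hv : Orthonormal 𝕜 v) {u : E} (hu : ‖u‖ = 1)
    (hvu : ∀ i, inner 𝕜 (v i) u = 0) : Orthonormal 𝕜 (Fin.snoc v u : Fin (n + 1) → E) := by
  refine ⟨Fin.lastCases ?_ fun i => ?_, Fin.lastCases (Fin.lastCases ?_ fun j => ?_) fun i =>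
    Fin.lastCases ?_ fun j => ?_⟩
  · simpa using hu
  · simpa using hv.1 i
  · simp
  · simpa using fun _ => inner_eq_zero_symm.1 (hvu j)
  · simpa using hvu i
  · simpa using fun hij => hv.2 hij

variable [Fintype ι] {v : ι → E} (hv : Orthonormal 𝕜 v)
include hv

theorem starProjection_span_range_apply (x : E) :
    (Submodule.span 𝕜 (Set.range v)).starProjection x = ∑ i, inner 𝕜 (v i) x • v i := by
  refine Submodule.eq_starProjection_of_mem_orthogonal
    (Submodule.sum_mem _ fun i _ => Submodule.smul_mem _ _
      (Submodule.subset_span (Set.mem_range_self i))) ?_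
  refine mem_orthogonal_span_range.2 fun i => ?_
  rw [inner_sub_right, hv.inner_right_fintype, sub_self]

theorem norm_starProjection_span_range_sq (x : E) :
    ‖(Submodule.span 𝕜 (Set.range v)).starProjection x‖ ^ 2 = ∑ i, ‖inner 𝕜 (v i) x‖ ^ 2 := by
  rw [starProjection_span_range_apply hv, ← RCLike.ofReal_inj (K := 𝕜), RCLike.ofReal_pow,
    ← inner_self_eq_norm_sq_to_K, hv.inner_sum]
  simp only [RCLike.conj_mul, RCLike.ofReal_sum, RCLike.ofReal_pow]

end OrthonormalFamilies

section CompactOperators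

variable {𝕜 E F : Type*} [RCLike 𝕜] [NormedAddCommGroup E] [InnerProductSpace 𝕜 E]
  [NormedAddCommGroup F] [InnerProductSpace 𝕜 F]

theorem starProjection_map_of_isSymmetric {T : E →ₗ[𝕜] E} (hT : T.IsSymmetric)
    {V : Submodule 𝕜 E} [V.HasOrthogonalProjection] (hV : ∀ x ∈ V, T x ∈ V) (x : E) :
    V.starProjection (T x) = T (V.starProjection x) := by
  refine Submodule.eq_starProjection_of_mem_orthogonal (hV _ (V.starProjection_apply_mem x)) ?_
  rw [← map_sub]
  refine (V.mem_orthogonal _).2 fun y hy => ?_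
  rw [← hT]
  exact (V.mem_orthogonal _).1 (V.sub_starProjection_mem_orthogonal x) _ (hV y hy)

theorem norm_mem_spectrum_of_isPositive [Nontrivial E] {T : E →L[𝕜] E} (hT : T.IsPositive) :
    algebraMap ℝ 𝕜 ‖T‖ ∈ spectrum 𝕜 T := by
  intro hres
  obtain ⟨ε, hε, hle⟩ := T.rayleighQuotient_le_of_norm_mem_resolventSet hres
  have habs (x : E) : |T.rayleighQuotient x| ≤ ‖T‖ - ε := by
    have hnonneg : 0 ≤ T.rayleighQuotient x :=
      div_nonneg (hT.re_inner_nonneg_left x) (sq_nonneg _)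
    exact (abs_of_nonneg hnonneg).trans_le (hle x)
  have hnorm := T.norm_eq_iSup_rayleighQuotient hT.isSymmetric
  linarith [ciSup_le habs]

variable [CompleteSpace E] [CompleteSpace F]

theorem exists_eigenvector_norm_of_isPositive [Nontrivial E] {T : E →L[𝕜] E} (hT : T.IsPositive)
    (hc : IsCompactOperator T) : ∃ u : E, ‖u‖ = 1 ∧ T u = algebraMap ℝ 𝕜 ‖T‖ • u := by
  obtain ⟨w, hw, hTw⟩ : ∃ w : E, w ≠ 0 ∧ T w = algebraMap ℝ 𝕜 ‖T‖ • w := by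
    rcases eq_or_ne T 0 with rfl | hT0
    · obtain ⟨w, hw⟩ := exists_ne (0 : E)
      exact ⟨w, hw, by simp⟩
    · have hne : algebraMap ℝ 𝕜 ‖T‖ ≠ 0 := by simpa using hT0
      obtain ⟨w, hw⟩ := ((hc.hasEigenvalue_iff_mem_spectrum hne).2
        (norm_mem_spectrum_of_isPositive hT)).exists_hasEigenvector
      exact ⟨w, hw.2, hw.apply_eq_smul⟩
  refine ⟨(‖w‖⁻¹ : 𝕜) • w, by simp [norm_smul, norm_ne_zero_iff.2 hw], ?_⟩
  rw [map_smul, hTw, smul_comm]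

theorem exists_mem_adjoint_apply_eq {A : E →L[𝕜] F} (hA : IsCompactOperator A)
    {K : Submodule 𝕜 E} [CompleteSpace K] (hK : ∀ y ∈ K, adjoint A (A y) ∈ K) (hK0 : K ≠ ⊥) :
    ∃ u ∈ K, ‖u‖ = 1 ∧ adjoint A (A u) = algebraMap ℝ 𝕜 (‖A.comp K.subtypeL‖ ^ 2) • u := by
  have : Nontrivial K := (Submodule.nontrivial_iff_ne_bot).2 hK0
  set B := A.comp K.subtypeL with hB
  obtain ⟨u, hu, hBu⟩ := exists_eigenvector_norm_of_isPositive
    (ContinuousLinearMap.isPositive_adjoint_comp_self B)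
    ((hA.comp_clm K.subtypeL).clm_comp (adjoint B))
  refine ⟨u, u.2, hu, ?_⟩
  rw [ContinuousLinearMap.norm_adjoint_comp_self, ← sq, ContinuousLinearMap.comp_apply, hB,
    ContinuousLinearMap.adjoint_comp, Submodule.adjoint_subtypeL] at hBu
  have hproj := congrArg (Subtype.val : K → E) hBu
  simpa [Submodule.starProjection_eq_self_iff.2 (hK u u.2)] using hproj

end CompactOperators

section SingularValues

variable {H F : Type*} [NormedAddCommGroup H] [InnerProductSpace ℝ H] [CompleteSpace H]
  [NormedAddCommGroup F] [InnerProductSpace ℝ F] [CompleteSpace F] {A : H →L[ℝ] F}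

/-- The span of the right singular vectors of `A` for the singular values `t ≥ s`; its rank decides
in the definition of `singularValue` how many singular values of `A` are at least `s`. -/
noncomputable def upperSingularSpace (A : H →L[ℝ] F) (s : ℝ) : Submodule ℝ H :=
  ⨆ t ∈ Set.Ici s, rightSingularSpace A t

theorem mem_rightSingularSpace {s : ℝ} {x : H} :
    x ∈ rightSingularSpace A s ↔ adjoint A (A x) = s ^ 2 • x :=
  Module.End.mem_eigenspace_iff

theorem rightSingularSpace_le_upperSingularSpace {s t : ℝ} (hst : s ≤ t) :
    rightSingularSpace A t ≤ upperSingularSpace A s :=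
  le_iSup₂_of_le t hst le_rfl

theorem norm_apply_of_mem_rightSingularSpace {s : ℝ} (hs : 0 ≤ s) {x : H}
    (hx : x ∈ rightSingularSpace A s) : ‖A x‖ = s * ‖x‖ := by
  rw [← pow_left_inj₀ (norm_nonneg _) (by positivity) two_ne_zero, ← real_inner_self_eq_norm_sq,
    ← ContinuousLinearMap.adjoint_inner_left, mem_rightSingularSpace.1 hx, real_inner_smul_left,
    real_inner_self_eq_norm_sq, mul_pow]

theorem starProjection_mem_rightSingularSpace {V : Submodule ℝ H} [V.HasOrthogonalProjection]
    (hV : ∀ x ∈ V, adjoint A (A x) ∈ V) {s : ℝ} {x : H} (hx : x ∈ rightSingularSpace A s) :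
    V.starProjection x ∈ rightSingularSpace A s := by
  have hcomm := starProjection_map_of_isSymmetric
    (ContinuousLinearMap.isPositive_adjoint_comp_self A).isSymmetric hV x
  rw [mem_rightSingularSpace] at hx ⊢
  rw [← map_smul, ← hx]
  exact hcomm.symm

theorem upperSingularSpace_le {V : Submodule ℝ H} [V.HasOrthogonalProjection]
    (hV : ∀ x ∈ V, adjoint A (A x) ∈ V) {c s : ℝ} (hs : 0 ≤ s) (hcs : c < s)
    (hc : ∀ y ∈ Vᗮ, ‖A y‖ ≤ c * ‖y‖) : upperSingularSpace A s ≤ V := by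
  refine iSup₂_le fun t (hst : s ≤ t) x hx => ?_
  have hz : x - V.starProjection x ∈ rightSingularSpace A t :=
    Submodule.sub_mem _ hx (starProjection_mem_rightSingularSpace hV hx)
  have hle := hc _ (V.sub_starProjection_mem_orthogonal x)
  rw [norm_apply_of_mem_rightSingularSpace (hs.trans hst) hz] at hle
  have hz0 : x - V.starProjection x = 0 := by
    by_contra hne
    exact (hcs.trans_le hst).not_ge (le_of_mul_le_mul_right hle (norm_pos_iff.2 hne))
  rw [← Submodule.starProjection_eq_self_iff, ← sub_eq_zero.1 hz0]

theorem singularValue_nonneg (A : H →L[ℝ] F) (n : ℕ) : 0 ≤ singularValue A n :=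
  Real.sSup_nonneg fun _ hs => hs.1

theorem le_singularValue {n : ℕ} {s : ℝ} (hs : 0 ≤ s)
    (hn : (n : Cardinal) < Module.rank ℝ (upperSingularSpace A s)) : s ≤ singularValue A n := by
  refine le_csSup ⟨‖A‖, fun t ⟨ht, hnt⟩ => ?_⟩ ⟨hs, hn⟩
  by_contra! hAt
  have hbot : upperSingularSpace A t ≤ ⊥ :=
    upperSingularSpace_le (by simp) ht hAt fun y _ => A.le_opNorm y
  exact (hnt.trans_le (Submodule.rank_mono hbot)).not_ge (by simp)

theorem singularValue_le {n : ℕ} {c : ℝ} (hc : 0 ≤ c)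
    (h : ∀ s, c < s → Module.rank ℝ (upperSingularSpace A s) ≤ n) : singularValue A n ≤ c :=
  Real.sSup_le (fun s hs => not_lt.1 fun hcs => hs.2.not_ge (h s hcs)) hc

theorem singularValue_antitone (A : H →L[ℝ] F) : Antitone (singularValue A) := fun m _ hmn =>
  Real.sSup_le (fun _ hs => le_singularValue hs.1 ((Nat.cast_le.2 hmn).trans_lt hs.2))
    (singularValue_nonneg A m)

theorem singularValue_eq_zero_of_rank_le (A : H →L[ℝ] F) {n : ℕ} (hn : Module.rank ℝ H ≤ n) :
    singularValue A n = 0 :=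
  (singularValue_le le_rfl fun _ _ => (Submodule.rank_le _).trans hn).antisymm
    (singularValue_nonneg A n)

theorem le_singularValue_of_linearIndependent {n : ℕ} {v : Fin (n + 1) → H}
    (hv : LinearIndependent ℝ v) {s : ℝ} (hs : 0 ≤ s) (hvs : ∀ i, v i ∈ upperSingularSpace A s) :
    s ≤ singularValue A n := by
  refine le_singularValue hs ?_
  calc (n : Cardinal) < (n + 1 : ℕ) := by exact_mod_cast n.lt_succ_self
    _ = Module.rank ℝ (Submodule.span ℝ (Set.range v)) :=
      (rank_span_range_of_linearIndependent hv).symm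
    _ ≤ _ := Submodule.rank_mono (Submodule.span_le.2 (Set.range_subset_iff.2 hvs))

end SingularValues

section TopRightSingularVectors

variable {H F : Type*} [NormedAddCommGroup H] [InnerProductSpace ℝ H] [CompleteSpace H]
  [NormedAddCommGroup F] [InnerProductSpace ℝ F] [CompleteSpace F] {A : H →L[ℝ] F}
  {n : ℕ} {v : Fin n → H}

namespace IsTopRightSingularVectors

theorem comp (hv : IsTopRightSingularVectors A v) {m : ℕ} {e : Fin m → Fin n}
    (he : Function.Injective e) (hσ : ∀ i, singularValue A (e i) = singularValue A i) :
    IsTopRightSingularVectors A (v ∘ e) :=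
  ⟨hv.1.comp e he, fun i => by rw [Function.comp_apply, hv.2, hσ]⟩

theorem adjoint_apply_mem_span (hv : IsTopRightSingularVectors A v) :
    ∀ x ∈ Submodule.span ℝ (Set.range v), adjoint A (A x) ∈ Submodule.span ℝ (Set.range v) := by
  suffices h : Submodule.span ℝ (Set.range v) ≤
      (Submodule.span ℝ (Set.range v)).comap ((adjoint A).comp A : H →ₗ[ℝ] H) from fun x hx => h hx
  refine Submodule.span_le.2 (Set.range_subset_iff.2 fun i => ?_)
  change adjoint A (A (v i)) ∈ Submodule.span ℝ (Set.range v)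
  rw [hv.2 i]
  exact Submodule.smul_mem _ _ (Submodule.subset_span (Set.mem_range_self i))

theorem adjoint_apply_mem_orthogonal (hv : IsTopRightSingularVectors A v) {x : H}
    (hx : x ∈ (Submodule.span ℝ (Set.range v))ᗮ) :
    adjoint A (A x) ∈ (Submodule.span ℝ (Set.range v))ᗮ := by
  refine (Submodule.mem_orthogonal _ _).2 fun y hy => ?_
  rw [ContinuousLinearMap.adjoint_inner_right, ← ContinuousLinearMap.adjoint_inner_left]
  exact (Submodule.mem_orthogonal _ _).1 hx _ (hv.adjoint_apply_mem_span y hy)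

theorem mem_upperSingularSpace (hv : IsTopRightSingularVectors A v) {s : ℝ} {i : Fin n}
    (hs : s ≤ singularValue A i) : v i ∈ upperSingularSpace A s :=
  rightSingularSpace_le_upperSingularSpace hs (mem_rightSingularSpace.2 (hv.2 i))

theorem le_singularValue (hv : IsTopRightSingularVectors A v) {s : ℝ} (hs : 0 ≤ s) {u : H}
    (hu : ‖u‖ = 1) (hvu : u ∈ (Submodule.span ℝ (Set.range v))ᗮ)
    (hus : u ∈ rightSingularSpace A s) : s ≤ singularValue A n := by
  rw [mem_orthogonal_span_range] at hvu
  suffices h : ∀ m ≤ n, s ≤ singularValue A m from h n le_rfl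
  -- Once `s ≤ σ` holds below `m`, the vectors `v 0, …, v (m - 1), u` give multiplicity `m + 1`.
  intro m
  induction m using Nat.strong_induction_on with
  | _ m ih =>
    intro hm
    have horth : Orthonormal ℝ (Fin.snoc (fun i : Fin m => v (i.castLE hm)) u : Fin (m + 1) → H) :=
      orthonormal_snoc (hv.1.comp _ (Fin.castLE_injective hm)) hu fun i => hvu _
    refine le_singularValue_of_linearIndependent horth.linearIndependent hs
      (Fin.lastCases ?_ fun i => ?_)
    · rw [Fin.snoc_last]
      exact rightSingularSpace_le_upperSingularSpace le_rfl hus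
    · rw [Fin.snoc_castSucc]
      exact hv.mem_upperSingularSpace (ih i i.2 (i.2.le.trans hm))

theorem norm_comp_orthogonal_subtypeL (hA : IsCompactOperator A)
    (hv : IsTopRightSingularVectors A v) :
    ‖A.comp (Submodule.span ℝ (Set.range v))ᗮ.subtypeL‖ = singularValue A n := by
  set K := (Submodule.span ℝ (Set.range v))ᗮ
  refine le_antisymm ?_ (singularValue_le (ContinuousLinearMap.opNorm_nonneg _) fun s hs => ?_)
  · rcases eq_or_ne K ⊥ with hK | hK
    · have : Subsingleton K := Submodule.subsingleton_iff_eq_bot.2 hK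
      rw [ContinuousLinearMap.opNorm_subsingleton]
      exact singularValue_nonneg A n
    · obtain ⟨u, huK, hu, hAu⟩ :=
        exists_mem_adjoint_apply_eq hA (fun _ => hv.adjoint_apply_mem_orthogonal) hK
      exact hv.le_singularValue (ContinuousLinearMap.opNorm_nonneg _) hu huK
        (mem_rightSingularSpace.2 hAu)
  · rw [← rank_span_range_of_linearIndependent hv.1.linearIndependent]
    exact Submodule.rank_mono (upperSingularSpace_le hv.adjoint_apply_mem_span
      ((ContinuousLinearMap.opNorm_nonneg _).trans hs.le) hs
      fun y hy => (A.comp K.subtypeL).le_opNorm ⟨y, hy⟩)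

theorem norm_apply_le (hA : IsCompactOperator A) (hv : IsTopRightSingularVectors A v) {y : H}
    (hy : y ∈ (Submodule.span ℝ (Set.range v))ᗮ) : ‖A y‖ ≤ singularValue A n * ‖y‖ := by
  rw [← hv.norm_comp_orthogonal_subtypeL hA]
  exact (A.comp (Submodule.subtypeL _)).le_opNorm ⟨y, hy⟩

theorem exists_snoc (hA : IsCompactOperator A) (hv : IsTopRightSingularVectors A v)
    (hn : (n : Cardinal) < Module.rank ℝ H) :
    ∃ u, IsTopRightSingularVectors A (Fin.snoc v u : Fin (n + 1) → H) := by
  have hK : (Submodule.span ℝ (Set.range v))ᗮ ≠ ⊥ := by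
    rw [Ne, Submodule.orthogonal_eq_bot_iff]
    intro htop
    have hrank := rank_span_range_of_linearIndependent hv.1.linearIndependent
    rw [htop, rank_top] at hrank
    exact hn.ne' hrank
  obtain ⟨u, huK, hu, hAu⟩ :=
    exists_mem_adjoint_apply_eq hA (fun _ => hv.adjoint_apply_mem_orthogonal) hK
  rw [hv.norm_comp_orthogonal_subtypeL hA] at hAu
  refine ⟨u, orthonormal_snoc hv.1 hu (mem_orthogonal_span_range.1 huK),
    Fin.lastCases ?_ fun i => ?_⟩
  · simpa using hAu
  · simpa using hv.2 i

end IsTopRightSingularVectors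

theorem exists_isTopRightSingularVectors (hA : IsCompactOperator A) :
    ∀ n : ℕ, (n : Cardinal) ≤ Module.rank ℝ H → ∃ v : Fin n → H, IsTopRightSingularVectors A v
  | 0, _ => ⟨Fin.elim0, ⟨fun i => i.elim0, fun i => i.elim0⟩, fun i => i.elim0⟩
  | n + 1, hn => by
    have hlt : (n : Cardinal) < Module.rank ℝ H :=
      lt_of_lt_of_le (by exact_mod_cast n.lt_succ_self) hn
    obtain ⟨v, hv⟩ := exists_isTopRightSingularVectors hA n hlt.le
    obtain ⟨u, hu⟩ := hv.exists_snoc hA hlt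
    exact ⟨_, hu⟩

end TopRightSingularVectors

section KyFan

variable {H F : Type*} [NormedAddCommGroup H] [InnerProductSpace ℝ H] [CompleteSpace H]
  [NormedAddCommGroup F] [InnerProductSpace ℝ F] [CompleteSpace F] {A : H →L[ℝ] F}
  {d : ℕ} {v u : Fin d → H}

namespace IsTopRightSingularVectors

theorem norm_apply (hv : IsTopRightSingularVectors A v) (i : Fin d) :
    ‖A (v i)‖ = singularValue A i := by
  rw [norm_apply_of_mem_rightSingularSpace (singularValue_nonneg A i)
    (mem_rightSingularSpace.2 (hv.2 i)), hv.1.1 i, mul_one]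

theorem norm_apply_sq_eq_sum_add (hv : IsTopRightSingularVectors A v) (y : H) :
    ‖A y‖ ^ 2 = ∑ i : Fin d, singularValue A i ^ 2 * inner ℝ (v i) y ^ 2 +
      ‖A (y - (Submodule.span ℝ (Set.range v)).starProjection y)‖ ^ 2 := by
  set p := (Submodule.span ℝ (Set.range v)).starProjection y with hp
  have hinner (w : H) :
      inner ℝ (A p) (A w) =
        ∑ i : Fin d, singularValue A i ^ 2 * inner ℝ (v i) y * inner ℝ (v i) w := by
    rw [← ContinuousLinearMap.adjoint_inner_left, hp, starProjection_span_range_apply hv.1,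
      map_sum, map_sum, sum_inner]
    refine Finset.sum_congr rfl fun i _ => ?_
    rw [map_smul, map_smul, hv.2 i, real_inner_smul_left, real_inner_smul_left]
    ring
  have horth : inner ℝ (A p) (A (y - p)) = 0 := by
    rw [hinner]
    refine Finset.sum_eq_zero fun i _ => ?_
    rw [mem_orthogonal_span_range.1 (Submodule.sub_starProjection_mem_orthogonal y) i, mul_zero]
  have hpp : ‖A p‖ ^ 2 = inner ℝ (A p) (A y) := by
    rw [map_sub, inner_sub_right, sub_eq_zero] at horth
    rw [horth, real_inner_self_eq_norm_sq]
  rw [show A y = A p + A (y - p) by rw [← map_add, add_sub_cancel], norm_add_sq_real, horth, hpp,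
    hinner]
  simp only [mul_zero, add_zero, mul_assoc, sq]

theorem norm_apply_sq_le (hA : IsCompactOperator A) (hv : IsTopRightSingularVectors A v) (y : H) :
    ‖A y‖ ^ 2 ≤
      ∑ i : Fin d, (singularValue A i ^ 2 - singularValue A d ^ 2) * inner ℝ (v i) y ^ 2 +
        singularValue A d ^ 2 * ‖y‖ ^ 2 := by
  set V := Submodule.span ℝ (Set.range v)
  have hpyth : ‖y‖ ^ 2 = ∑ i, inner ℝ (v i) y ^ 2 + ‖y - V.starProjection y‖ ^ 2 := by
    rw [V.norm_sq_eq_add_norm_sq_starProjection y, norm_starProjection_span_range_sq hv.1,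
      V.starProjection_orthogonal_val]
    simp only [Real.norm_eq_abs, sq_abs]
  have hle : ‖A (y - V.starProjection y)‖ ^ 2 ≤
      singularValue A d ^ 2 * ‖y - V.starProjection y‖ ^ 2 := by
    rw [← mul_pow]
    exact pow_le_pow_left₀ (norm_nonneg _)
      (hv.norm_apply_le hA (V.sub_starProjection_mem_orthogonal y)) 2
  rw [hv.norm_apply_sq_eq_sum_add y, hpyth]
  simp only [sub_mul, Finset.sum_sub_distrib, ← Finset.mul_sum, mul_add]
  linarith

theorem sum_gap_mul_le (hA : IsCompactOperator A) (hv : IsTopRightSingularVectors A v)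
    (hu : Orthonormal ℝ u) :
    ∑ i : Fin d, (singularValue A i ^ 2 - singularValue A d ^ 2) *
        (1 - ‖(Submodule.span ℝ (Set.range u)).starProjection (v i)‖ ^ 2) ≤
      ∑ i : Fin d, singularValue A i ^ 2 - ∑ j, ‖A (u j)‖ ^ 2 := by
  have hsum : ∑ j, ‖A (u j)‖ ^ 2 ≤ ∑ i : Fin d, (singularValue A i ^ 2 - singularValue A d ^ 2) *
      ‖(Submodule.span ℝ (Set.range u)).starProjection (v i)‖ ^ 2 + d * singularValue A d ^ 2 := by
    refine (Finset.sum_le_sum fun j _ => hv.norm_apply_sq_le hA (u j)).trans_eq ?_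
    rw [Finset.sum_add_distrib, Finset.sum_comm]
    simp only [norm_starProjection_span_range_sq hu, Finset.mul_sum, Real.norm_eq_abs, sq_abs,
      real_inner_comm, hu.1, one_pow, mul_one, Finset.sum_const, Finset.card_univ,
      Fintype.card_fin, nsmul_eq_mul]
  simp only [mul_sub, Finset.sum_sub_distrib, mul_one, Finset.sum_const, Finset.card_univ,
    Fintype.card_fin, nsmul_eq_mul] at hsum ⊢
  linarith

theorem gap_mul_nonneg (hv : IsTopRightSingularVectors A v) (U : Submodule ℝ H)
    [U.HasOrthogonalProjection] (i : Fin d) :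
    0 ≤ (singularValue A i ^ 2 - singularValue A d ^ 2) * (1 - ‖U.starProjection (v i)‖ ^ 2) := by
  refine mul_nonneg (sub_nonneg.2 ?_) (sub_nonneg.2 ?_)
  · exact pow_le_pow_left₀ (singularValue_nonneg A d) (singularValue_antitone A i.2.le) 2
  · exact pow_le_one₀ (norm_nonneg _) (hv.1.1 i ▸ U.norm_starProjection_apply_le (v i))

theorem span_eq_of_sum_norm_apply_sq_eq (hA : IsCompactOperator A)
    (hv : IsTopRightSingularVectors A v) (hgap : ∀ i : Fin d, singularValue A d < singularValue A i)
    (hu : Orthonormal ℝ u) (heq : ∑ j, ‖A (u j)‖ ^ 2 = ∑ i : Fin d, singularValue A i ^ 2) :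
    Submodule.span ℝ (Set.range u) = Submodule.span ℝ (Set.range v) := by
  set U := Submodule.span ℝ (Set.range u)
  have hsum := (hv.sum_gap_mul_le hA hu).trans_eq (sub_eq_zero.2 heq.symm)
  have hle : Submodule.span ℝ (Set.range v) ≤ U := by
    refine Submodule.span_le.2 (Set.range_subset_iff.2 fun i => ?_)
    have hterm := (Finset.single_le_sum (fun i _ => hv.gap_mul_nonneg U i)
      (Finset.mem_univ i)).trans hsum
    have hpos : 0 < singularValue A i ^ 2 - singularValue A d ^ 2 :=
      sub_pos.2 (pow_lt_pow_left₀ (hgap i) (singularValue_nonneg A d) two_ne_zero)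
    have hone : 1 ≤ ‖U.starProjection (v i)‖ :=
      (one_le_sq_iff₀ (norm_nonneg _)).1 (sub_nonpos.1 (nonpos_of_mul_nonpos_right hterm hpos))
    refine (U.mem_iff_norm_starProjection (v i)).2 (le_antisymm
      (U.norm_starProjection_apply_le (v i)) ?_)
    rwa [hv.1.1 i]
  refine (Submodule.eq_of_le_of_finrank_eq hle ?_).symm
  rw [finrank_span_eq_card hv.1.linearIndependent, finrank_span_eq_card hu.linearIndependent]

end IsTopRightSingularVectors

theorem sum_norm_apply_sq_le_sum_singularValue_sq (hA : IsCompactOperator A)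
    (hu : Orthonormal ℝ u) : ∑ j, ‖A (u j)‖ ^ 2 ≤ ∑ i : Fin d, singularValue A i ^ 2 := by
  obtain ⟨v, hv⟩ := exists_isTopRightSingularVectors hA d
    (rank_span_range_of_linearIndependent hu.linearIndependent ▸ Submodule.rank_le _)
  exact sub_nonneg.1 ((Finset.sum_nonneg fun i _ => hv.gap_mul_nonneg _ i).trans
    (hv.sum_gap_mul_le hA hu))

end KyFan

section InnerLp

variable {Ω H : Type*} [MeasurableSpace Ω] {ν : Measure Ω} [NormedAddCommGroup H]
  [InnerProductSpace ℝ H]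

/-- The operator `y ↦ ⟪y, f ·⟫` from `H` to `L²(ν)` attached to `f ∈ L²(ν; H)`, as a function of
`f`. The data-to-features operator is the case of the centered data. -/
noncomputable def innerLp (ν : Measure Ω) : Lp H 2 ν →L[ℝ] H →L[ℝ] Lp ℝ 2 ν :=
  LinearMap.mkContinuous₂
    (LinearMap.mk₂ ℝ (fun f y => (innerSL ℝ y).compLp f)
      (fun f g y => ((innerSL ℝ y).compLpL 2 ν).map_add f g)
      (fun c f y => ((innerSL ℝ y).compLpL 2 ν).map_smul c f)
      (fun f y z => by rw [map_add, ContinuousLinearMap.add_compLp])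
      (fun c f y => by rw [map_smul, ContinuousLinearMap.smul_compLp]))
    1 fun f y => by
      have h := (innerSL ℝ y).norm_compLp_le f
      rwa [innerSL_apply_norm, mul_comm, ← one_mul ‖f‖] at h

theorem coeFn_innerLp (f : Lp H 2 ν) (y : H) :
    innerLp ν f y =ᵐ[ν] fun x => inner ℝ y (f x) :=
  (innerSL ℝ y).coeFn_compLp f

theorem Lp_norm_sq_eq_integral (f : Lp H 2 ν) : ‖f‖ ^ 2 = ∫ x, ‖f x‖ ^ 2 ∂ν := by
  rw [← real_inner_self_eq_norm_sq, L2.inner_def]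
  simp only [real_inner_self_eq_norm_sq]

theorem norm_innerLp_sq (f : Lp H 2 ν) (y : H) :
    ‖innerLp ν f y‖ ^ 2 = ∫ x, inner ℝ y (f x) ^ 2 ∂ν := by
  rw [Lp_norm_sq_eq_integral]
  refine integral_congr_ae ?_
  filter_upwards [coeFn_innerLp f y] with x hx
  rw [hx, Real.norm_eq_abs, sq_abs]

theorem norm_compLp_sq {G : Type*} [NormedAddCommGroup G] [InnerProductSpace ℝ G] (P : H →L[ℝ] G)
    (f : Lp H 2 ν) : ‖P.compLp f‖ ^ 2 = ∫ x, ‖P (f x)‖ ^ 2 ∂ν := by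
  rw [Lp_norm_sq_eq_integral]
  refine integral_congr_ae ?_
  filter_upwards [P.coeFn_compLp f] with x hx
  rw [hx]

theorem sum_norm_innerLp_sq {ι : Type*} [Fintype ι] {u : ι → H} (hu : Orthonormal ℝ u)
    {V : Submodule ℝ H} [V.HasOrthogonalProjection] (hV : Submodule.span ℝ (Set.range u) = V)
    (f : Lp H 2 ν) : ∑ i, ‖innerLp ν f (u i)‖ ^ 2 = ‖V.starProjection.compLp f‖ ^ 2 := by
  subst hV
  simp only [norm_innerLp_sq, norm_compLp_sq, norm_starProjection_span_range_sq hu,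
    Real.norm_eq_abs, sq_abs]
  exact (integral_finsetSum _ fun i _ => ((Lp.memLp f).const_inner (u i)).integrable_sq).symm

theorem norm_sq_eq_add_norm_starProjection_compLp_sq (V : Submodule ℝ H)
    [V.HasOrthogonalProjection] (f : Lp H 2 ν) :
    ‖f‖ ^ 2 = ‖V.starProjection.compLp f‖ ^ 2 + ‖Vᗮ.starProjection.compLp f‖ ^ 2 := by
  have hint (P : H →L[ℝ] H) : Integrable (fun x => ‖P (f x)‖ ^ 2) ν :=
    (P.comp_memLp f).norm.integrable_sq
  rw [norm_compLp_sq, norm_compLp_sq, ← integral_add (hint _) (hint _), Lp_norm_sq_eq_integral]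
  simp only [← V.norm_sq_eq_add_norm_sq_starProjection]

theorem norm_starProjection_compLp_le (V : Submodule ℝ H) [V.HasOrthogonalProjection]
    (f : Lp H 2 ν) : ‖V.starProjection.compLp f‖ ≤ ‖f‖ :=
  (V.starProjection.norm_compLp_le f).trans
    (mul_le_of_le_one_left (norm_nonneg f) V.starProjection_norm_le)

theorem norm_orthogonal_starProjection_compLp_le (f : Lp H 2 ν) {V : Submodule ℝ H}
    [V.HasOrthogonalProjection] {g : Lp H 2 ν} (hg : ∀ᵐ x ∂ν, g x ∈ V) :
    ‖Vᗮ.starProjection.compLp f‖ ≤ dist f g := by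
  have hQg : Vᗮ.starProjection.compLpL 2 ν g = 0 := by
    refine Lp.ext ?_
    filter_upwards [Vᗮ.starProjection.coeFn_compLp g, hg, Lp.coeFn_zero H 2 ν] with x hx hxV h0
    refine hx.trans (Eq.trans ?_ h0.symm)
    exact Submodule.starProjection_orthogonal_apply_eq_zero hxV
  have hQf : Vᗮ.starProjection.compLp f = Vᗮ.starProjection.compLp (f - g) :=
    (sub_zero _).symm.trans (hQg ▸ (map_sub (Vᗮ.starProjection.compLpL 2 ν) f g).symm)
  rw [hQf, dist_eq_norm]
  exact norm_starProjection_compLp_le _ _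

theorem exists_finiteDimensional_dist_lt (f : Lp H 2 ν) {ε : ℝ} (hε : 0 < ε) :
    ∃ (V : Submodule ℝ H) (_ : FiniteDimensional ℝ V) (g : Lp H 2 ν),
      (∀ᵐ x ∂ν, g x ∈ V) ∧ dist f g < ε := by
  obtain ⟨g, hg⟩ := (Lp.simpleFunc.denseRange (μ := ν) (E := H) (p := 2)
    ENNReal.ofNat_ne_top).exists_dist_lt f hε
  refine ⟨Submodule.span ℝ (Set.range (Lp.simpleFunc.toSimpleFunc g)),
    FiniteDimensional.span_of_finite ℝ (SimpleFunc.finite_range _), g, ?_, hg⟩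
  filter_upwards [Lp.simpleFunc.toSimpleFunc_eq_toFun g] with x hx
  exact hx ▸ Submodule.subset_span (Set.mem_range_self x)

theorem isCompactOperator_innerLp_of_mem {V : Submodule ℝ H} [FiniteDimensional ℝ V]
    {g : Lp H 2 ν} (hg : ∀ᵐ x ∂ν, g x ∈ V) : IsCompactOperator (innerLp ν g) := by
  have hfactor : innerLp ν g = ((innerLp ν g).comp V.subtypeL).comp V.orthogonalProjectionOnto := by
    ext1 y
    refine Lp.ext ?_
    filter_upwards [hg, coeFn_innerLp g y, coeFn_innerLp g (V.starProjection y)] with x hx hy hPy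
    rw [hy, ← Submodule.starProjection_eq_self_iff.2 hx,
      ← Submodule.inner_starProjection_left_eq_right, ← hPy]
    rfl
  rw [hfactor]
  have : ProperSpace V := FiniteDimensional.proper ℝ V
  exact (isCompactOperator_of_locallyCompactSpace_rng ((innerLp ν g).comp V.subtypeL)).comp_clm
    V.orthogonalProjectionOnto

theorem isCompactOperator_innerLp (f : Lp H 2 ν) : IsCompactOperator (innerLp ν f) := by
  have hclosed : IsClosed {f : Lp H 2 ν | IsCompactOperator (innerLp ν f)} :=
    isClosed_setOfPred_isCompactOperator.preimage (innerLp ν).continuous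
  refine hclosed.closure_subset (Metric.mem_closure_iff.2 fun ε hε => ?_)
  obtain ⟨V, _, g, hgV, hfg⟩ := exists_finiteDimensional_dist_lt f hε
  exact ⟨g, isCompactOperator_innerLp_of_mem hgV, hfg⟩

variable [CompleteSpace H]

theorem sum_singularValue_innerLp_sq_le (f : Lp H 2 ν) (n : ℕ) :
    ∑ i ∈ Finset.range n, singularValue (innerLp ν f) i ^ 2 ≤ ‖f‖ ^ 2 := by
  induction n with
  | zero => simp
  | succ n ih =>
    rcases le_or_gt ((n + 1 : ℕ) : Cardinal) (Module.rank ℝ H) with hn | hn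
    · obtain ⟨v, hv⟩ := exists_isTopRightSingularVectors (isCompactOperator_innerLp f) _ hn
      rw [← Fin.sum_univ_eq_sum_range (fun i => singularValue (innerLp ν f) i ^ 2)]
      simp only [← hv.norm_apply]
      rw [sum_norm_innerLp_sq hv.1 rfl]
      exact pow_le_pow_left₀ (norm_nonneg _) (norm_starProjection_compLp_le _ f) 2
    · have hrank : Module.rank ℝ H ≤ n := Order.lt_succ_iff.1 (by simpa using hn)
      rwa [Finset.sum_range_succ, singularValue_eq_zero_of_rank_le _ hrank, sq, mul_zero, add_zero]

theorem summable_singularValue_innerLp_sq (f : Lp H 2 ν) :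
    Summable fun i => singularValue (innerLp ν f) i ^ 2 :=
  summable_of_sum_range_le (fun _ => sq_nonneg _) (sum_singularValue_innerLp_sq_le f)

theorem norm_starProjection_compLp_sq_le (f : Lp H 2 ν) (V : Submodule ℝ H)
    [FiniteDimensional ℝ V] :
    ‖V.starProjection.compLp f‖ ^ 2 ≤ ∑' i, singularValue (innerLp ν f) i ^ 2 := by
  obtain ⟨d, hd⟩ : ∃ d : ℕ, Module.rank ℝ V = d := ⟨_, (Module.finrank_eq_rank ℝ V).symm⟩
  obtain ⟨u, hu, rfl⟩ := exists_orthonormal_span_eq hd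
  rw [← sum_norm_innerLp_sq hu rfl]
  refine (sum_norm_apply_sq_le_sum_singularValue_sq (isCompactOperator_innerLp f) hu).trans ?_
  rw [Fin.sum_univ_eq_sum_range (fun i => singularValue (innerLp ν f) i ^ 2)]
  exact (summable_singularValue_innerLp_sq f).sum_le_tsum _ fun i _ => sq_nonneg _

theorem hasSum_singularValue_innerLp_sq (f : Lp H 2 ν) :
    HasSum (fun i => singularValue (innerLp ν f) i ^ 2) (‖f‖ ^ 2) := by
  set S := ∑' i, singularValue (innerLp ν f) i ^ 2
  have hle : ‖f‖ ^ 2 ≤ S := by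
    refine le_of_forall_pos_le_add fun ε hε => ?_
    obtain ⟨V, _, g, hgV, hfg⟩ := exists_finiteDimensional_dist_lt f (Real.sqrt_pos.2 hε)
    rw [norm_sq_eq_add_norm_starProjection_compLp_sq V f]
    refine add_le_add (norm_starProjection_compLp_sq_le f V) ?_
    exact (Real.le_sqrt (norm_nonneg _) hε.le).1
      ((norm_orthogonal_starProjection_compLp_le f hgV).trans hfg.le)
  have hge : S ≤ ‖f‖ ^ 2 :=
    Real.tsum_le_of_sum_range_le (fun _ => sq_nonneg _) (sum_singularValue_innerLp_sq_le f)
  rw [hle.antisymm hge]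
  exact (summable_singularValue_innerLp_sq f).hasSum

end InnerLp

section Flats

variable {H : Type*} [NormedAddCommGroup H] [InnerProductSpace ℝ H]

theorem mk'_mem_affineGrassmannian {d : ℕ} {v : Fin d → H} (hv : LinearIndependent ℝ v) (p : H) :
    AffineSubspace.mk' p (Submodule.span ℝ (Set.range v)) ∈ affineGrassmannian H d :=
  ⟨⟨p, AffineSubspace.self_mem_mk' _ _⟩, by
    rw [AffineSubspace.direction_mk', rank_span_range_of_linearIndependent hv]⟩

theorem finiteDimensional_direction {d : ℕ} {L : AffineSubspace ℝ H}
    (hL : L ∈ affineGrassmannian H d) : FiniteDimensional ℝ L.direction :=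
  Module.rank_lt_aleph0_iff.1 (hL.2 ▸ Cardinal.natCast_lt_aleph0)

theorem isClosed_of_mem_affineGrassmannian {d : ℕ} {L : AffineSubspace ℝ H}
    (hL : L ∈ affineGrassmannian H d) : IsClosed (L : Set H) :=
  have := finiteDimensional_direction hL
  (AffineSubspace.isClosed_direction_iff L).1 L.direction.closed_of_finiteDimensional

theorem eq_top_of_mem_affineGrassmannian {d : ℕ} (hd : (d : Cardinal) = Module.rank ℝ H)
    {L : AffineSubspace ℝ H} (hL : L ∈ affineGrassmannian H d) : L = ⊤ := by
  have : Module.Finite ℝ H := Module.rank_lt_aleph0_iff.1 (hd ▸ Cardinal.natCast_lt_aleph0)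
  refine (AffineSubspace.direction_eq_top_iff_of_nonempty hL.1).1 ?_
  exact Submodule.eq_top_of_finrank_eq (by rw [Module.finrank, Module.finrank, hL.2, hd])

theorem infDist_eq_norm_orthogonal_starProjection {L : AffineSubspace ℝ H}
    [L.direction.HasOrthogonalProjection] {p : H} (hp : p ∈ L) (x : H) :
    Metric.infDist x (L : Set H) = ‖L.directionᗮ.starProjection (x - p)‖ := by
  have : Nonempty L := ⟨⟨p, hp⟩⟩
  have hproj : (EuclideanGeometry.orthogonalProjection L x : H) =
      L.direction.starProjection (x - p) + p := by
    rw [EuclideanGeometry.coe_orthogonalProjection_eq_iff_mem]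
    refine ⟨AffineSubspace.vadd_mem_of_mem_direction
      (Submodule.starProjection_apply_mem _ _) hp, ?_⟩
    rw [vsub_eq_sub, sub_add_eq_sub_sub_swap]
    exact Submodule.sub_starProjection_mem_orthogonal _
  rw [← EuclideanGeometry.dist_orthogonalProjection_eq_infDist, hproj, dist_eq_norm,
    sub_add_eq_sub_sub_swap, ← Submodule.starProjection_orthogonal_val]

end Flats

section LeastSquaresError

variable {H : Type*} [NormedAddCommGroup H] [InnerProductSpace ℝ H] [MeasurableSpace H]
  {μ : Measure H} {d : ℕ}

theorem rmsDist_nonneg (μ : Measure H) (L : AffineSubspace ℝ H) : 0 ≤ rmsDist μ L :=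
  Real.sqrt_nonneg _

theorem rmsDist_sq (μ : Measure H) (L : AffineSubspace ℝ H) :
    rmsDist μ L ^ 2 = ∫ x, Metric.infDist x (L : Set H) ^ 2 ∂μ :=
  Real.sq_sqrt (integral_nonneg fun _ => sq_nonneg _)

theorem IsLSFlat.lsError_eq {L : AffineSubspace ℝ H} (hL : IsLSFlat μ d L) :
    lsError μ d = rmsDist μ L := by
  have : Nonempty (affineGrassmannian H d) := ⟨⟨L, hL.1⟩⟩
  refine le_antisymm (ciInf_le (f := fun M : affineGrassmannian H d => rmsDist μ M) ?_ ⟨L, hL.1⟩)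
    (le_ciInf fun M => hL.2 M.2)
  exact ⟨0, Set.forall_mem_range.2 fun _ => rmsDist_nonneg μ _⟩

theorem IsLSFlat.existsUnique_of_eq_rank {L : AffineSubspace ℝ H} (hL : IsLSFlat μ d L)
    (hd : (d : Cardinal) = Module.rank ℝ H) : ∃! L : AffineSubspace ℝ H, IsLSFlat μ d L :=
  ⟨L, hL, fun _ hM => (eq_top_of_mem_affineGrassmannian hd hM.1).trans
    (eq_top_of_mem_affineGrassmannian hd hL.1).symm⟩

end LeastSquaresError

section ParallelAxis

theorem integral_norm_sub_const_sq {Ω E : Type*} [MeasurableSpace Ω] {ν : Measure Ω}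
    [IsProbabilityMeasure ν] [NormedAddCommGroup E] [InnerProductSpace ℝ E] [CompleteSpace E]
    {f : Ω → E} (hf : MemLp f 2 ν) (a : E) :
    ∫ x, ‖f x - a‖ ^ 2 ∂ν = ∫ x, ‖f x - ∫ y, f y ∂ν‖ ^ 2 ∂ν + ‖∫ y, f y ∂ν - a‖ ^ 2 := by
  set m := ∫ y, f y ∂ν
  have hint : Integrable f ν := hf.integrable one_le_two
  have hdev : Integrable (fun x => f x - m) ν := hint.sub (integrable_const m)
  have hcentered : ∫ x, (f x - m) ∂ν = 0 := by
    rw [integral_sub hint (integrable_const m), integral_const, probReal_univ, one_smul, sub_self]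
  have hcross : ∫ x, 2 * inner ℝ (m - a) (f x - m) ∂ν = 0 := by
    rw [integral_const_mul, integral_inner hdev, hcentered, inner_zero_right, mul_zero]
  have hexpand (x : Ω) : ‖f x - a‖ ^ 2 =
      ‖f x - m‖ ^ 2 + (2 * inner ℝ (m - a) (f x - m) + ‖m - a‖ ^ 2) := by
    rw [← sub_add_sub_cancel (f x) m a, norm_add_sq_real, real_inner_comm, add_assoc]
  have hsq : Integrable (fun x => ‖f x - m‖ ^ 2) ν := (hf.sub (memLp_const m)).norm.integrable_sq
  have hlin : Integrable (fun x => 2 * inner ℝ (m - a) (f x - m)) ν :=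
    (hdev.const_inner (m - a)).const_mul 2
  have hlin_add : Integrable (fun x => 2 * inner ℝ (m - a) (f x - m) + ‖m - a‖ ^ 2) ν :=
    hlin.add (integrable_const _)
  simp only [hexpand]
  rw [integral_add hsq hlin_add, integral_add hlin (integrable_const _),
    hcross, integral_const, probReal_univ, one_smul, zero_add]

end ParallelAxis

section MeanSquare

variable {H : Type*} [NormedAddCommGroup H] [InnerProductSpace ℝ H] [MeasurableSpace H]
  {μ : Measure H} [IsProbabilityMeasure μ]

/-- The centered data `x ↦ x - x_cm` of a measure with finite second moment, as an element of
`L²(μ; H)`; its image under `innerLp μ` is the data-to-features operator. -/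
noncomputable def centeredData (hμ : MemLp id 2 μ) : Lp H 2 μ :=
  (hμ.sub (memLp_const (centerOfMass μ))).toLp (fun x => x - centerOfMass μ)

theorem coeFn_centeredData (hμ : MemLp id 2 μ) :
    centeredData hμ =ᵐ[μ] fun x => x - centerOfMass μ :=
  MemLp.coeFn_toLp _

variable [CompleteSpace H]

theorem rmsDist_sq_eq_add_infDist_centerOfMass_sq (hμ : MemLp id 2 μ) {L : AffineSubspace ℝ H}
    [L.direction.HasOrthogonalProjection] (hL : (L : Set H).Nonempty) :
    rmsDist μ L ^ 2 = ‖L.directionᗮ.starProjection.compLp (centeredData hμ)‖ ^ 2 +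
      Metric.infDist (centerOfMass μ) (L : Set H) ^ 2 := by
  obtain ⟨p, hp⟩ := hL
  set Q := L.directionᗮ.starProjection
  have hmean : ∫ x, Q x ∂μ = Q (centerOfMass μ) := Q.integral_comp_comm (hμ.integrable one_le_two)
  have hparallel := integral_norm_sub_const_sq (Q.comp_memLp' hμ) (Q p)
  simp only [Function.comp_apply, id_eq, hmean, ← map_sub] at hparallel
  rw [rmsDist_sq]
  simp only [infDist_eq_norm_orthogonal_starProjection hp]
  rw [hparallel, norm_compLp_sq]
  congr 1
  refine integral_congr_ae ?_
  filter_upwards [coeFn_centeredData hμ] with x hx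
  rw [hx]

theorem rmsDist_sq_eq (hμ : MemLp id 2 μ) {d : ℕ} {L : AffineSubspace ℝ H}
    (hL : (L : Set H).Nonempty) {u : Fin d → H} (hu : Orthonormal ℝ u)
    (hspan : Submodule.span ℝ (Set.range u) = L.direction) :
    rmsDist μ L ^ 2 = ∑' i, singularValue (innerLp μ (centeredData hμ)) (d + i) ^ 2 +
      (∑ i : Fin d, singularValue (innerLp μ (centeredData hμ)) i ^ 2 -
        ∑ j, ‖innerLp μ (centeredData hμ) (u j)‖ ^ 2) +
      Metric.infDist (centerOfMass μ) (L : Set H) ^ 2 := by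
  have : FiniteDimensional ℝ L.direction := hspan ▸ finiteDimensional_span_range u
  have hsum := hasSum_singularValue_innerLp_sq (centeredData hμ)
  have hsplit := hsum.summable.sum_add_tsum_nat_add d
  rw [hsum.tsum_eq, norm_sq_eq_add_norm_starProjection_compLp_sq L.direction,
    ← sum_norm_innerLp_sq hu hspan,
    ← Fin.sum_univ_eq_sum_range (fun i => singularValue (innerLp μ (centeredData hμ)) i ^ 2)]
    at hsplit
  rw [rmsDist_sq_eq_add_infDist_centerOfMass_sq hμ hL]
  simp only [add_comm d]
  linarith

end MeanSquare

section LeastSquares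

variable {H : Type*} [NormedAddCommGroup H] [InnerProductSpace ℝ H] [CompleteSpace H]
  [MeasurableSpace H] {μ : Measure H} [IsProbabilityMeasure μ] (hμ : MemLp id 2 μ) {d : ℕ}
include hμ

theorem sqrt_tsum_singularValue_sq_le_rmsDist {L : AffineSubspace ℝ H}
    (hL : L ∈ affineGrassmannian H d) :
    √(∑' i, singularValue (innerLp μ (centeredData hμ)) (d + i) ^ 2) ≤ rmsDist μ L := by
  obtain ⟨u, hu, hspan⟩ := exists_orthonormal_span_eq hL.2
  have hKyFan := sum_norm_apply_sq_le_sum_singularValue_sq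
    (isCompactOperator_innerLp (centeredData hμ)) hu
  refine Real.sqrt_le_iff.2 ⟨rmsDist_nonneg μ L, ?_⟩
  rw [rmsDist_sq_eq hμ hL.1 hu hspan, add_assoc]
  exact le_add_of_nonneg_right (add_nonneg (sub_nonneg.2 hKyFan) (sq_nonneg _))

theorem rmsDist_eq_sqrt_tsum_singularValue_sq_iff {L : AffineSubspace ℝ H}
    (hL : L ∈ affineGrassmannian H d) {u : Fin d → H} (hu : Orthonormal ℝ u)
    (hspan : Submodule.span ℝ (Set.range u) = L.direction) :
    rmsDist μ L = √(∑' i, singularValue (innerLp μ (centeredData hμ)) (d + i) ^ 2) ↔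
      centerOfMass μ ∈ L ∧ ∑ j, ‖innerLp μ (centeredData hμ) (u j)‖ ^ 2 =
        ∑ i : Fin d, singularValue (innerLp μ (centeredData hμ)) i ^ 2 := by
  have hKyFan := sum_norm_apply_sq_le_sum_singularValue_sq
    (isCompactOperator_innerLp (centeredData hμ)) hu
  have hclosed := isClosed_of_mem_affineGrassmannian hL
  rw [← sq_eq_sq₀ (rmsDist_nonneg μ L) (Real.sqrt_nonneg _),
    Real.sq_sqrt (tsum_nonneg fun _ => sq_nonneg _), rmsDist_sq_eq hμ hL.1 hu hspan, add_assoc,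
    add_eq_left, add_eq_zero_iff_of_nonneg (sub_nonneg.2 hKyFan) (sq_nonneg _),
    sub_eq_zero, sq_eq_zero_iff, ← SetLike.mem_coe, hclosed.mem_iff_infDist_zero hL.1, and_comm,
    eq_comm (a := ∑ i : Fin d, singularValue _ i ^ 2)]

theorem rmsDist_mk'_span_of_isTopRightSingularVectors {v : Fin d → H}
    (hv : IsTopRightSingularVectors (innerLp μ (centeredData hμ)) v) :
    rmsDist μ (AffineSubspace.mk' (centerOfMass μ) (Submodule.span ℝ (Set.range v))) =
      √(∑' i, singularValue (innerLp μ (centeredData hμ)) (d + i) ^ 2) :=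
  (rmsDist_eq_sqrt_tsum_singularValue_sq_iff hμ
    (mk'_mem_affineGrassmannian hv.1.linearIndependent _) hv.1
    (AffineSubspace.direction_mk' _ _).symm).2
    ⟨AffineSubspace.self_mem_mk' _ _, Finset.sum_congr rfl fun i _ => by rw [hv.norm_apply]⟩

theorem isLSFlat_mk'_span_of_isTopRightSingularVectors {v : Fin d → H}
    (hv : IsTopRightSingularVectors (innerLp μ (centeredData hμ)) v) :
    IsLSFlat μ d (AffineSubspace.mk' (centerOfMass μ) (Submodule.span ℝ (Set.range v))) :=
  ⟨mk'_mem_affineGrassmannian hv.1.linearIndependent _, fun _ hL =>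
    (rmsDist_mk'_span_of_isTopRightSingularVectors hμ hv).trans_le
      (sqrt_tsum_singularValue_sq_le_rmsDist hμ hL)⟩

theorem IsLSFlat.rmsDist_eq {L : AffineSubspace ℝ H} (hL : IsLSFlat μ d L) :
    rmsDist μ L = √(∑' i, singularValue (innerLp μ (centeredData hμ)) (d + i) ^ 2) := by
  have hd : (d : Cardinal) ≤ Module.rank ℝ H := hL.1.2 ▸ Submodule.rank_le _
  obtain ⟨v, hv⟩ :=
    exists_isTopRightSingularVectors (isCompactOperator_innerLp (centeredData hμ)) d hd
  rw [← rmsDist_mk'_span_of_isTopRightSingularVectors hμ hv]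
  exact (hL.2 (isLSFlat_mk'_span_of_isTopRightSingularVectors hμ hv).1).antisymm
    ((isLSFlat_mk'_span_of_isTopRightSingularVectors hμ hv).2 hL.1)

theorem existsUnique_isLSFlat_of_forall_singularValue_lt (hd : (d : Cardinal) ≤ Module.rank ℝ H)
    (hgap : ∀ i : Fin d, singularValue (innerLp μ (centeredData hμ)) d <
      singularValue (innerLp μ (centeredData hμ)) i) :
    ∃! L : AffineSubspace ℝ H, IsLSFlat μ d L := by
  have hA := isCompactOperator_innerLp (centeredData hμ)
  obtain ⟨v, hv⟩ := exists_isTopRightSingularVectors hA d hd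
  refine ⟨_, isLSFlat_mk'_span_of_isTopRightSingularVectors hμ hv, fun L hL => ?_⟩
  obtain ⟨u, hu, hspan⟩ := exists_orthonormal_span_eq hL.1.2
  obtain ⟨hc, hsum⟩ :=
    (rmsDist_eq_sqrt_tsum_singularValue_sq_iff hμ hL.1 hu hspan).1 (hL.rmsDist_eq hμ)
  rw [← hv.span_eq_of_sum_norm_apply_sq_eq hA hgap hu hsum, hspan, AffineSubspace.mk'_eq hc]

theorem not_existsUnique_isLSFlat_of_singularValue_eq
    (hd : ((d + 1 : ℕ) : Cardinal) < Module.rank ℝ H)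
    (heq : singularValue (innerLp μ (centeredData hμ)) (d + 1) =
      singularValue (innerLp μ (centeredData hμ)) d) :
    ¬ ∃! L : AffineSubspace ℝ H, IsLSFlat μ (d + 1) L := by
  intro huniq
  have hd2 : ((d + 2 : ℕ) : Cardinal) ≤ Module.rank ℝ H := by
    rw [Nat.cast_succ, ← Cardinal.succ_natCast]
    exact Order.succ_le_of_lt hd
  obtain ⟨v, hv⟩ :=
    exists_isTopRightSingularVectors (isCompactOperator_innerLp (centeredData hμ)) _ hd2
  set e := (Fin.last d).castSucc.succAbove
  have hdropLast := hv.comp (Fin.castSucc_injective (d + 1)) fun _ => rfl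
  have hdropPenultimate := hv.comp (Fin.succAbove_right_injective (p := (Fin.last d).castSucc))
    fun i => by
      induction i using Fin.lastCases with
      | last => rw [Fin.succAbove_castSucc_self]; exact heq
      | cast i =>
        rw [Fin.succAbove_of_castSucc_lt _ _
          (Fin.castSucc_lt_castSucc_iff.2 (Fin.castSucc_lt_last i)), Fin.val_castSucc]
  have hspan : Submodule.span ℝ (Set.range (v ∘ Fin.castSucc)) =
      Submodule.span ℝ (Set.range (v ∘ e)) := by
    simpa only [AffineSubspace.direction_mk'] using congrArg AffineSubspace.direction
      (huniq.unique (isLSFlat_mk'_span_of_isTopRightSingularVectors hμ hdropLast)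
        (isLSFlat_mk'_span_of_isTopRightSingularVectors hμ hdropPenultimate))
  have hmem : v (Fin.last d).castSucc ∈ Submodule.span ℝ (Set.range (v ∘ e)) :=
    hspan ▸ Submodule.subset_span ⟨Fin.last d, rfl⟩
  have horth : v (Fin.last d).castSucc ∈ (Submodule.span ℝ (Set.range (v ∘ e)))ᗮ :=
    mem_orthogonal_span_range.2 fun i => hv.1.2 (Fin.succAbove_ne _ i)
  exact hv.1.ne_zero _ (inner_self_eq_zero.1 ((Submodule.mem_orthogonal _ _).1 horth _ hmem))

theorem existsUnique_isLSFlat_iff (hd : ((d + 1 : ℕ) : Cardinal) < Module.rank ℝ H) :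
    (∃! L : AffineSubspace ℝ H, IsLSFlat μ (d + 1) L) ↔
      singularValue (innerLp μ (centeredData hμ)) (d + 1) <
        singularValue (innerLp μ (centeredData hμ)) d := by
  have hanti := singularValue_antitone (innerLp μ (centeredData hμ))
  refine ⟨fun huniq => (hanti d.le_succ).lt_of_ne fun heq => ?_, fun hgap => ?_⟩
  · exact not_existsUnique_isLSFlat_of_singularValue_eq hμ hd heq huniq
  · exact existsUnique_isLSFlat_of_forall_singularValue_lt hμ hd.le fun i =>
      hgap.trans_le (hanti (Nat.lt_succ_iff.1 i.2))

end LeastSquares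

section BoundedSupport

theorem memLp_id_of_isBounded_support {E : Type*} [NormedAddCommGroup E]
    [TopologicalSpace.SeparableSpace E] [MeasurableSpace E] [OpensMeasurableSpace E] {μ : Measure E}
    [IsFiniteMeasure μ] (hμ : Bornology.IsBounded μ.support) {p : ENNReal} : MemLp id p μ := by
  have : SecondCountableTopology E := UniformSpace.secondCountable_of_separable E
  obtain ⟨C, hC⟩ := hμ.exists_norm_le
  refine MemLp.of_bound stronglyMeasurable_id.aestronglyMeasurable C ?_
  filter_upwards [Measure.support_mem_ae] with x hx using hC x hx

variable {H : Type*} [NormedAddCommGroup H] [InnerProductSpace ℝ H]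
  [TopologicalSpace.SeparableSpace H] [MeasurableSpace H] [BorelSpace H]
  {μ : Measure H} [IsProbabilityMeasure μ]

theorem dataToFeatures_eq_innerLp (hμ : Bornology.IsBounded μ.support) :
    dataToFeatures μ hμ = innerLp μ (centeredData (memLp_id_of_isBounded_support hμ)) :=
  rfl

end BoundedSupport

end LeastSquaresFlats

theorem mainTheorem5_general {H : Type*} [NormedAddCommGroup H] [InnerProductSpace ℝ H]
    [CompleteSpace H] [MeasurableSpace H] (μ : Measure H) [IsProbabilityMeasure μ]
    (hμ : MemLp id 2 μ) (d : ℕ) (hd : (d : Cardinal) ≤ Module.rank ℝ H) :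
    (∃ L : AffineSubspace ℝ H, IsLSFlat μ d L) ∧
    (∃ v : Fin d → H, IsTopRightSingularVectors (innerLp μ (centeredData hμ)) v) ∧
    (∀ v : Fin d → H, IsTopRightSingularVectors (innerLp μ (centeredData hμ)) v →
      IsLSFlat μ d
        (AffineSubspace.mk' (centerOfMass μ) (Submodule.span ℝ (Set.range v)))) ∧
    (1 ≤ d → (d : Cardinal) < Module.rank ℝ H →
      ((∃! L : AffineSubspace ℝ H, IsLSFlat μ d L) ↔
        singularValue (innerLp μ (centeredData hμ)) d <
          singularValue (innerLp μ (centeredData hμ)) (d - 1))) ∧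
    (d = 0 ∨ (d : Cardinal) = Module.rank ℝ H → ∃! L : AffineSubspace ℝ H, IsLSFlat μ d L) ∧
    Summable (fun i : ℕ => singularValue (innerLp μ (centeredData hμ)) (d + i) ^ 2) ∧
    lsError μ d = √(∑' i : ℕ, singularValue (innerLp μ (centeredData hμ)) (d + i) ^ 2) := by
  obtain ⟨v, hv⟩ :=
    exists_isTopRightSingularVectors (isCompactOperator_innerLp (centeredData hμ)) d hd
  have hL := isLSFlat_mk'_span_of_isTopRightSingularVectors hμ hv
  refine ⟨⟨_, hL⟩, ⟨v, hv⟩, fun w hw => isLSFlat_mk'_span_of_isTopRightSingularVectors hμ hw,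
    ?_, ?_, ?_, hL.lsError_eq.trans (hL.rmsDist_eq hμ)⟩
  · intro h1 hlt
    obtain ⟨k, rfl⟩ := Nat.exists_eq_add_of_le' h1
    exact existsUnique_isLSFlat_iff hμ hlt
  · rintro (rfl | hrank)
    · exact existsUnique_isLSFlat_of_forall_singularValue_lt hμ hd fun i => i.elim0
    · exact hL.existsUnique_of_eq_rank hrank
  · simp only [add_comm d]
    exact (summable_nat_add_iff d).2 (summable_singularValue_innerLp_sq (centeredData hμ))

theorem mainTheorem5 {H : Type*} [NormedAddCommGroup H] [InnerProductSpace ℝ H] [CompleteSpace H]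
    [TopologicalSpace.SeparableSpace H] [MeasurableSpace H] [BorelSpace H]
    (μ : Measure H) [IsProbabilityMeasure μ] (hμ : Bornology.IsBounded μ.support)
    (d : ℕ) (hd : (d : Cardinal) ≤ Module.rank ℝ H) :
    -- a least squares `d`-flat exists
    (∃ L : AffineSubspace ℝ H, IsLSFlat μ d L) ∧
    -- top right singular vectors exist, and each choice of them gives a least squares `d`-flat
    (∃ v : Fin d → H, IsTopRightSingularVectors (dataToFeatures μ hμ) v) ∧
    (∀ v : Fin d → H, IsTopRightSingularVectors (dataToFeatures μ hμ) v →
      IsLSFlat μ d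
        (AffineSubspace.mk' (centerOfMass μ) (Submodule.span ℝ (Set.range v)))) ∧
    -- uniqueness: `σ_d > σ_{d+1}`, where `singularValue _ n` is `σ_{n+1}`
    (1 ≤ d → (d : Cardinal) < Module.rank ℝ H →
      ((∃! L : AffineSubspace ℝ H, IsLSFlat μ d L) ↔
        singularValue (dataToFeatures μ hμ) d < singularValue (dataToFeatures μ hμ) (d - 1))) ∧
    (d = 0 ∨ (d : Cardinal) = Module.rank ℝ H → ∃! L : AffineSubspace ℝ H, IsLSFlat μ d L) ∧
    -- the least squares error
    Summable (fun i : ℕ => singularValue (dataToFeatures μ hμ) (d + i) ^ 2) ∧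
    lsError μ d = √(∑' i : ℕ, singularValue (dataToFeatures μ hμ) (d + i) ^ 2) := by
  rw [dataToFeatures_eq_innerLp]
  exact mainTheorem5_general μ (memLp_id_of_isBounded_support hμ) d hd
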